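/- Let $k$ be an algebraically closed field of characteristic zero, $A$ a finitely generated associative unital $k$-algebra, $A^e=A\otimes_k A^{\mathrm{op}}$, and $n\ge 0$. Assume that $A$ is $2$-Calabi--Yau: $A$ has a finite resolution by finitely generated projective left $A^e$-modules, $\mathrm{Ext}^i_{A^e}(A,A^e)=0$ for $i\neq 2$, and $\mathrm{Ext}^2_{A^e}(A,A^e)\cong A$ as $A$-bimodules (the bimodule structure on $\mathrm{Ext}$ being induced by the right multiplications of $A^e$ on itself). Let $\mathrm{Rep}^n_A=\mathrm{Spec}\,V_n(A)$ be the scheme of $n$-dimensional representations of $A$, where $V_n(A)$ is the commutative $k$-algebra representing $B\mapsto \mathrm{Hom}_{k\text{-alg}}(A,\mathrm{Mat}_n(B))$, and give the set of its $k$-points $\mathrm{Rep}^n_A(k)=\mathrm{Hom}_{k\text{-alg}}(A,\mathrm{Mat}_n(k))$ the Zariski topology. For a point $M\in\mathrm{Rep}^n_A(k)$, also write $M$ for the corresponding $A$-module $k^n$, regard $\mathrm{End}_k(M)$ as an $A^e$-module by $(a\otimes b)f=a\circ f\circ b$, and let $T_M\mathrm{Rep}^n_A=(\mathfrak m_M/\mathfrak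 m_M^2)^*$ be the Zariski tangent space of the scheme $\mathrm{Rep}^n_A$ at $M$. Let $F_\bullet\to A$ be a resolution of $A$ by finitely generated projective left $A^e$-modules such that the functions $$c^i:\mathrm{Rep}^n_A(k)\to\mathbb N,\qquad M\mapsto \dim_k\mathrm{Hom}_{A^e}(F_i,\mathrm{End}_k(M))$$ are locally constant for $i=0,1,2$. Then there is a locally constant function $N:\mathrm{Rep}^n_A(k)\to\mathbb Z$ such that $$\dim_k T_M\mathrm{Rep}^n_A=N(M)+\dim_k\mathrm{End}_A(M)\qquad\text{for all } M\in\mathrm{Rep}^n_A(k).$$ In particular, for every irreducible component $Z$ of $\mathrm{Rep}^n_A(k)$ there is a strictly increasing function $f:\mathbb N\to\mathbb Z$ such that $\dim_k T_M\mathrm{Rep}^n_A=f(\dim_k\mathrm{End}_A(M))$ for all $M\in Z$. -/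

import Mathlib

open TensorProduct CategoryTheory

universe u

noncomputable section

namespace CYRep

/-! ### Enveloping algebra and Calabi-Yau algebras -/

section CalabiYau

variable (k A : Type u) [Field k] [Ring A] [Algebra k A]

/-- The enveloping algebra `Aᵉ = A ⊗ Aᵒᵖ`; left `Aᵉ`-modules are `A`-bimodules. -/
abbrev Env : Type u := A ⊗[k] Aᵐᵒᵖ

/-- `A` as a left `Aᵉ`-module: `(a ⊗ op b) • x = a * x * b`. -/
def diagBimod : ModuleCat.{u} (Env k A) :=
  letI : Module (Env k A) A := instModuleTensorProductMop k A
  ModuleCat.of (Env k A) A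

lemma diagBimod_smul (a b x : A) :
    (((a ⊗ₜ[k] MulOpposite.op b : Env k A) • (show diagBimod k A from x) : diagBimod k A) : A) =
      a * x * b :=
  AlgHom.mulLeftRight_apply k A a (MulOpposite.op b) x

/-- `Aᵉ` as a left module over itself (the outer bimodule structure of `A ⊗ A`). -/
abbrev envBimod : ModuleCat.{u} (Env k A) := ModuleCat.of (Env k A) (Env k A)

/-- Right multiplication `x ↦ x * s` on `Aᵉ`, a morphism of left `Aᵉ`-modules. -/
def envRightMul (s : Env k A) : envBimod k A ⟶ envBimod k A :=
  ModuleCat.ofHom (LinearMap.toSpanSingleton (Env k A) (Env k A) s)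

/-- `A` is homologically smooth: as an `Aᵉ`-module it has a finite resolution by finitely
generated projective `Aᵉ`-modules. -/
def HomologicallySmooth : Prop :=
  ∃ P : ProjectiveResolution (diagBimod k A),
    (∀ i, Module.Finite (Env k A) (P.complex.X i)) ∧
    ∃ m : ℕ, ∀ i, m < i → Limits.IsZero (P.complex.X i)

/-- `A` is `d`-Calabi-Yau: it is homologically smooth, `Extⁱ(A, Aᵉ) = 0` over `Aᵉ` for `i ≠ d`, and
`Extᵈ(A, Aᵉ) ≅ A` as `A`-bimodules. The bimodule structure of `Extᵈ(A, Aᵉ)` is the one induced by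
the right multiplications of `Aᵉ` on the second argument (the inner bimodule structure of `A ⊗ A`):
`b ξ a` is the image of `ξ` under right multiplication by `a ⊗ op b`, i.e. under
`x ⊗ op y ↦ x a ⊗ op (b y)`. -/
structure IsCalabiYau (d : ℕ) : Prop where
  smooth : HomologicallySmooth k A
  ext_eq_zero : ∀ i : ℕ, i ≠ d → Subsingleton (Abelian.Ext (diagBimod k A) (envBimod k A) i)
  ext_iso : ∃ e : Abelian.Ext (diagBimod k A) (envBimod k A) d ≃+ A,
    ∀ (a b : A) (ξ : Abelian.Ext (diagBimod k A) (envBimod k A) d),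
      e (ξ.comp (Abelian.Ext.mk₀ (envRightMul k A (a ⊗ₜ[k] MulOpposite.op b))) (add_zero d)) =
        b * e ξ * a

end CalabiYau

/-! ### The scheme of `n`-dimensional representations -/

section RepScheme

variable (k A : Type u) [Field k] [Ring A] [Algebra k A] (n : ℕ)

/-- The matrix of indeterminates `(x_{a,i,j})_{i,j}` attached to `a : A`. -/
def genMat (a : A) : Matrix (Fin n) (Fin n) (MvPolynomial (A × Fin n × Fin n) k) :=
  Matrix.of fun i j => MvPolynomial.X (a, i, j)

/-- The relations saying that `a ↦ (x_{a,i,j})_{i,j}` is a homomorphism of `k`-algebras. -/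
def repIdeal : Ideal (MvPolynomial (A × Fin n × Fin n) k) :=
  Ideal.span
    ({p | ∃ (a b : A) (i j : Fin n),
        p = (genMat k A n (a + b) - (genMat k A n a + genMat k A n b)) i j} ∪
     {p | ∃ (a b : A) (i j : Fin n),
        p = (genMat k A n (a * b) - genMat k A n a * genMat k A n b) i j} ∪
     {p | ∃ (c : k) (i j : Fin n),
        p = genMat k A n (algebraMap k A c) i j - if i = j then MvPolynomial.C c else 0})

/-- The coordinate ring `V_n(A)` of the scheme `Rep_A^n = Spec V_n(A)`. -/
abbrev RepRing : Type u := MvPolynomial (A × Fin n × Fin n) k ⧸ repIdeal k A n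

variable {k A n}

lemma repIdeal_le_ker {B : Type*} [CommRing B] [Algebra k B]
    (ρ : A →ₐ[k] Matrix (Fin n) (Fin n) B) :
    repIdeal k A n ≤ RingHom.ker
      (MvPolynomial.aeval (R := k) fun x : A × Fin n × Fin n => ρ x.1 x.2.1 x.2.2) := by
  refine Ideal.span_le.2 ?_
  rintro p ((⟨a, b, i, j, rfl⟩ | ⟨a, b, i, j, rfl⟩) | ⟨c, i, j, rfl⟩)
  · simp [genMat]
  · simp [genMat, Matrix.mul_apply]
  · by_cases h : i = j <;> simp [genMat, Matrix.algebraMap_matrix_apply, h]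

/-- The homomorphism `V_n(A) → B` classifying a representation of `A` over `B`. -/
def classify {B : Type*} [CommRing B] [Algebra k B]
    (ρ : A →ₐ[k] Matrix (Fin n) (Fin n) B) : RepRing k A n →ₐ[k] B :=
  Ideal.Quotient.liftₐ (repIdeal k A n)
    (MvPolynomial.aeval fun x : A × Fin n × Fin n => ρ x.1 x.2.1 x.2.2)
    fun _ hp => repIdeal_le_ker ρ hp

lemma classify_mk_X {B : Type*} [CommRing B] [Algebra k B]
    (ρ : A →ₐ[k] Matrix (Fin n) (Fin n) B) (x : A × Fin n × Fin n) :
    classify ρ (Ideal.Quotient.mk (repIdeal k A n) (MvPolynomial.X x)) = ρ x.1 x.2.1 x.2.2 := by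
  change MvPolynomial.aeval (R := k) (fun x : A × Fin n × Fin n => ρ x.1 x.2.1 x.2.2)
    (MvPolynomial.X x) = _
  simp

variable (k A n) in
/-- The matrix of the classes of the indeterminates attached to `a`. -/
def univMat (a : A) : Matrix (Fin n) (Fin n) (RepRing k A n) :=
  (genMat k A n a).map (Ideal.Quotient.mkₐ k (repIdeal k A n))

lemma univMat_add (a b : A) : univMat k A n (a + b) = univMat k A n a + univMat k A n b := by
  ext i j
  have h : (genMat k A n (a + b) - (genMat k A n a + genMat k A n b)) i j ∈ repIdeal k A n :=
    Ideal.subset_span (Or.inl (Or.inl ⟨a, b, i, j, rfl⟩))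
  have h' := (Ideal.Quotient.eq (I := repIdeal k A n)).2 h
  simpa [univMat] using h'

lemma univMat_mul (a b : A) : univMat k A n (a * b) = univMat k A n a * univMat k A n b := by
  ext i j
  have h : (genMat k A n (a * b) - genMat k A n a * genMat k A n b) i j ∈ repIdeal k A n :=
    Ideal.subset_span (Or.inl (Or.inr ⟨a, b, i, j, rfl⟩))
  have h' := (Ideal.Quotient.eq (I := repIdeal k A n)).2 h
  simpa [univMat, Matrix.mul_apply] using h'

lemma univMat_algebraMap (c : k) :
    univMat k A n (algebraMap k A c) = algebraMap k (Matrix (Fin n) (Fin n) (RepRing k A n)) c := by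
  ext i j
  have h : genMat k A n (algebraMap k A c) i j - (if i = j then MvPolynomial.C c else 0) ∈ repIdeal k A n :=
    Ideal.subset_span (Or.inr ⟨c, i, j, rfl⟩)
  have h' := (Ideal.Quotient.eq (I := repIdeal k A n)).2 h
  by_cases hij : i = j
  · subst hij
    simp only [univMat, Matrix.algebraMap_matrix_apply, Matrix.map_apply, if_true] at h' ⊢
    exact h'
  · simpa [univMat, Matrix.algebraMap_matrix_apply, hij] using h'

variable (k A n) in
/-- The universal `n`-dimensional representation `A → Mat_n(V_n(A))`. -/
def univRep : A →ₐ[k] Matrix (Fin n) (Fin n) (RepRing k A n) where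
  toFun := univMat k A n
  map_one' := by simpa using univMat_algebraMap (k := k) (A := A) (n := n) 1
  map_zero' := by simpa using univMat_algebraMap (k := k) (A := A) (n := n) 0
  map_add' := univMat_add
  map_mul' := univMat_mul
  commutes' := univMat_algebraMap

variable (k A n) in
/-- `V_n(A)` represents the functor `B ↦ Hom_{k-alg}(A, Mat_n(B))`. -/
def repEquiv (B : Type*) [CommRing B] [Algebra k B] :
    (RepRing k A n →ₐ[k] B) ≃ (A →ₐ[k] Matrix (Fin n) (Fin n) B) where
  toFun f := f.mapMatrix.comp (univRep k A n)
  invFun := classify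
  left_inv f := by
    refine Ideal.Quotient.algHom_ext k ?_
    refine MvPolynomial.algHom_ext fun x => ?_
    simp [classify_mk_X, univRep, univMat, genMat]
  right_inv ρ := by
    ext a i j
    simp [classify_mk_X, univRep, univMat, genMat]

variable (k A n) in
/-- The set `Rep_A^n(k)` of `n`-dimensional representations of `A` over `k`. -/
def RepPt : Type u := A →ₐ[k] Matrix (Fin n) (Fin n) k

namespace RepPt

variable (M : RepPt k A n)

/-- The maximal ideal of `V_n(A)` at the `k`-point `M`. -/
def maxIdeal : Ideal (RepRing k A n) := RingHom.ker (classify (A := A) (n := n) (B := k) M)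

instance : M.maxIdeal.IsPrime := RingHom.ker_isPrime _

/-- The `k`-point `M` as a point of `Spec V_n(A)`. -/
def toSpec : PrimeSpectrum (RepRing k A n) := ⟨M.maxIdeal, inferInstance⟩

/-- The Zariski topology on `Rep_A^n(k)`. -/
instance : TopologicalSpace (RepPt k A n) := TopologicalSpace.induced toSpec inferInstance

/-- The Zariski tangent space `T_M Rep_A^n = (𝔪 / 𝔪²)*`. -/
abbrev TangentSpace : Type u := Module.Dual k M.maxIdeal.Cotangent

/-- The `A`-module `kⁿ` given by the representation `M`. -/
def Mod (_ : RepPt k A n) : Type u := Fin n → k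

instance : AddCommGroup M.Mod := inferInstanceAs (AddCommGroup (Fin n → k))

instance : Module k M.Mod := inferInstanceAs (Module k (Fin n → k))

/-- The representation as a homomorphism `A → End_k(kⁿ)`. -/
def toEnd : A →ₐ[k] Module.End k M.Mod :=
  AlgHom.comp (Matrix.toLinAlgEquiv' (R := k) (n := Fin n)).toAlgHom M

instance : Module A M.Mod := Module.compHom M.Mod M.toEnd.toRingHom

lemma smul_def (a : A) (v : M.Mod) : a • v = M.toEnd a v := rfl

instance : SMulCommClass A k M.Mod where
  smul_comm a c v := by simp [smul_def]

/-- The action of `Aᵉ` on `End_k(M)`: `(a ⊗ op b) f = a ∘ f ∘ b`. -/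
def envAct : Env k A →ₐ[k] Module.End k (Module.End k M.Mod) :=
  (AlgHom.mulLeftRight k (Module.End k M.Mod)).comp
    (Algebra.TensorProduct.map M.toEnd (AlgHom.op M.toEnd))

instance : Module (Env k A) (Module.End k M.Mod) :=
  Module.compHom (Module.End k M.Mod) M.envAct.toRingHom

lemma env_smul_def (s : Env k A) (f : Module.End k M.Mod) : s • f = M.envAct s f := rfl

lemma tmul_smul_apply (a b : A) (f : Module.End k M.Mod) (v : M.Mod) :
    ((a ⊗ₜ[k] MulOpposite.op b : Env k A) • f) v = a • f (b • v) := by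
  simp [env_smul_def, smul_def, envAct]

instance : SMulCommClass (Env k A) k (Module.End k M.Mod) where
  smul_comm s c f := by simp [env_smul_def]

end RepPt

end RepScheme

end CYRep

end

/-!
Tangent vectors of the representation scheme at `M` are derivations `A → End_k(M)`, that is,
bimodule maps from the kernel of `Aᵉ → A`. By Schanuel's lemma this kernel may be traded for the
first syzygy `B₀` of any resolution `P` of `A` by finitely generated projectives. If `P` is finite,
the vanishing of `Ext` into `Aᵉ` above degree two makes the second syzygy `B₁ ⊆ P₁` projective, so
that by left exactness of `Hom(-, End_k(M))` on `B₁ → P₁ → B₀` only the corank of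
`Hom(P₁, End_k(M)) → Hom(B₁, End_k(M))` has to be found. Its cokernel is `HH₀(A, End_k(M))`, because
`Ext²(A, Aᵉ) ≅ A`, and the trace form makes this dual to `End_A(M)`. The remaining terms
`dim Hom(Y, End_k(M))`, with `Y` finitely generated projective, are locally constant in every
characteristic: a projector `e` of rank `d` satisfies `det (1 + (X - 1) e) = X ^ d`, and for the
projector cutting out `Hom(Y, End_k(M))` the coefficients of this polynomial are regular functions
of `M`.
-/

noncomputable section

namespace CYRep

/-! ### Projective modules and boundaries of resolutions -/

section Modules

variable {R : Type*} [Ring R] {P Q X : Type*} [AddCommGroup P] [Module R P] [AddCommGroup Q]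
  [Module R Q] [AddCommGroup X] [Module R X]

lemma exists_comp_eq_of_ker_le {Y : Type*} [AddCommGroup Y] [Module R Y] {q : Q →ₗ[R] X}
    (hq : Function.Surjective q) {f : Q →ₗ[R] Y} (h : LinearMap.ker q ≤ LinearMap.ker f) :
    ∃ g : X →ₗ[R] Y, g ∘ₗ q = f :=
  ⟨(LinearMap.ker q).liftQ f h ∘ₗ (q.quotKerEquivOfSurjective hq).symm, by ext; simp⟩

variable (R P) in
lemma exists_finite_dualBasis [Module.Finite R P] [Module.Projective R P] :
    ∃ (r : ℕ) (x : Fin r → P) (φ : Fin r → P →ₗ[R] R), ∀ p, ∑ i, φ i p • x i = p := by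
  obtain ⟨r, f, g, -, -, hfg⟩ := Module.Finite.exists_comp_eq_id_of_projective R P
  refine ⟨r, fun i => f (Pi.single i 1), fun i => LinearMap.proj i ∘ₗ g, fun p => ?_⟩
  conv_rhs => rw [← LinearMap.id_apply (R := R) p, ← hfg, LinearMap.comp_apply,
    ← Finset.univ_sum_single (g p), map_sum]
  refine Finset.sum_congr rfl fun i _ => ?_
  rw [LinearMap.comp_apply, LinearMap.proj_apply, ← map_smul, ← Pi.single_smul, smul_eq_mul,
    mul_one]

lemma exists_retraction_of_functionals_extend [Module.Finite R P] [Module.Projective R P]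
    (i : P →ₗ[R] Q) (h : ∀ φ : P →ₗ[R] R, ∃ ψ : Q →ₗ[R] R, ψ ∘ₗ i = φ) :
    ∃ ρ : Q →ₗ[R] P, ρ ∘ₗ i = LinearMap.id := by
  obtain ⟨r, x, φ, hx⟩ := exists_finite_dualBasis R P
  choose ψ hψ using h
  refine ⟨∑ j, (ψ (φ j)).smulRight (x j), LinearMap.ext fun p => ?_⟩
  have hφ (j) : ψ (φ j) (i p) = φ j p := LinearMap.congr_fun (hψ (φ j)) p
  simp [hφ, hx]

lemma projective_of_functionals_extend [Module.Finite R P] [Module.Projective R P]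
    [Module.Projective R Q] {i : P →ₗ[R] Q} {q : Q →ₗ[R] X} (hiq : Function.Exact i q)
    (hq : Function.Surjective q) (h : ∀ φ : P →ₗ[R] R, ∃ ψ : Q →ₗ[R] R, ψ ∘ₗ i = φ) :
    Module.Projective R X := by
  obtain ⟨-, σ, hσ⟩ := (hiq.split_tfae'.out 1 0 rfl rfl).1
    ⟨hq, exists_retraction_of_functionals_extend i h⟩
  exact .of_split σ q hσ

lemma exists_schanuel_equiv [Module.Projective R P] [Module.Projective R Q]
    {p : P →ₗ[R] X} {q : Q →ₗ[R] X} (hp : Function.Surjective p) (hq : Function.Surjective q) :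
    Nonempty ((LinearMap.ker p × Q) ≃ₗ[R] (LinearMap.ker q × P)) := by
  obtain ⟨s, hs⟩ := Module.projective_lifting_property p q hp
  obtain ⟨t, ht⟩ := Module.projective_lifting_property q p hq
  have hs' : ∀ y, p (s y) = q y := LinearMap.congr_fun hs
  have ht' : ∀ y, q (t y) = p y := LinearMap.congr_fun ht
  exact ⟨{
    toFun := fun z => (⟨z.2 - t (z.1 + s z.2), by simp [hs', ht']⟩, z.1 + s z.2)
    invFun := fun z => (⟨z.2 - s (z.1 + t z.2), by simp [hs', ht']⟩, z.1 + t z.2)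
    map_add' := fun a b => by ext <;> simp <;> abel
    map_smul' := fun c a => by ext <;> simp [smul_sub]
    left_inv := fun z => by ext <;> simp
    right_inv := fun z => by ext <;> simp }⟩

end Modules

section Boundaries

variable {R : Type u} [Ring R] {X : ModuleCat.{u} R} (P : ProjectiveResolution X)

/-- The boundaries of a projective resolution `P` in degree `i`: the image of `Pᵢ₊₁` in `Pᵢ`, that
is, the `(i + 1)`-st syzygy of the resolved module. -/
def boundaries (i : ℕ) : Submodule R (P.complex.X i) :=
  LinearMap.range (P.complex.d (i + 1) i).hom

/-- The differential `Pᵢ₊₁ → Pᵢ` with values in its image. -/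
def toBoundaries (i : ℕ) : P.complex.X (i + 1) →ₗ[R] boundaries P i :=
  (P.complex.d (i + 1) i).hom.rangeRestrict

lemma toBoundaries_surjective (i : ℕ) : Function.Surjective (toBoundaries P i) :=
  LinearMap.surjective_rangeRestrict _

lemma ker_toBoundaries (i : ℕ) : LinearMap.ker (toBoundaries P i) = boundaries P (i + 1) :=
  (LinearMap.ker_rangeRestrict _).trans (P.exact_succ i).moduleCat_range_eq_ker.symm

lemma exact_subtype_toBoundaries (i : ℕ) :
    Function.Exact (boundaries P (i + 1)).subtype (toBoundaries P i) :=
  LinearMap.exact_iff.2 ((ker_toBoundaries P i).trans (Submodule.range_subtype _).symm)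

/-- The augmentation `P₀ → X` of a projective resolution, as a map of modules. -/
def augmentation : P.complex.X 0 →ₗ[R] X := (P.π.f 0).hom

lemma augmentation_surjective : Function.Surjective (augmentation P) :=
  (ModuleCat.epi_iff_surjective (P.π.f 0)).1 inferInstance

lemma ker_augmentation : LinearMap.ker (augmentation P) = boundaries P 0 :=
  (ShortComplex.exact_of_g_is_cokernel
    (ShortComplex.mk _ _ P.complex_d_comp_π_f_zero)
      P.isColimitCokernelCofork).moduleCat_range_eq_ker.symm

lemma finite_boundaries (i : ℕ) [Module.Finite R (P.complex.X (i + 1))] :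
    Module.Finite R (boundaries P i) :=
  .of_surjective _ (toBoundaries_surjective P i)

instance projective_complex_X (i : ℕ) : Module.Projective R (P.complex.X i) :=
  (IsProjective.iff_projective _).2 (P.projective i)

variable (Y : ModuleCat.{u} R)

lemma d_comp_toBoundaries (i : ℕ) (φ : boundaries P i →ₗ[R] Y) :
    P.complex.d (i + 2) (i + 1) ≫ ModuleCat.ofHom (φ ∘ₗ toBoundaries P i) = 0 := by
  ext x
  have hx : (P.complex.d (i + 2) (i + 1)).hom x ∈ LinearMap.ker (toBoundaries P i) :=
    (ker_toBoundaries P i).symm ▸ LinearMap.mem_range_self _ x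
  simp [LinearMap.mem_ker.1 hx]

/-- The iterated connecting map `Hom(Bᵢ, Y) → Extⁱ⁺¹(X, Y)` for the boundaries `Bᵢ` of a
projective resolution of `X`: a homomorphism `Bᵢ → Y` is the cocycle `Pᵢ₊₁ → Bᵢ → Y`. -/
def boundaryExt (i : ℕ) : (boundaries P i →ₗ[R] Y) →+ Abelian.Ext X Y (i + 1) :=
  AddMonoidHom.mk' (fun φ => P.extMk (ModuleCat.ofHom (φ ∘ₗ toBoundaries P i)) _ rfl
    (d_comp_toBoundaries P Y i φ)) fun φ ψ => by rw [P.add_extMk]; rfl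

lemma boundaryExt_surjective (i : ℕ) : Function.Surjective (boundaryExt P Y i) := fun ξ => by
  obtain ⟨f, hf, rfl⟩ := P.extMk_surjective ξ _ rfl
  have hker : LinearMap.ker (toBoundaries P i) ≤ LinearMap.ker f.hom := by
    rw [ker_toBoundaries]
    rintro _ ⟨x, rfl⟩
    exact LinearMap.congr_fun (ModuleCat.hom_ext_iff.1 hf) x
  obtain ⟨φ, rfl⟩ : ∃ φ, f = ModuleCat.ofHom (φ ∘ₗ toBoundaries P i) := by
    obtain ⟨φ, hφ⟩ := exists_comp_eq_of_ker_le (toBoundaries_surjective P i) hker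
    exact ⟨φ, ModuleCat.hom_ext hφ.symm⟩
  exact ⟨φ, rfl⟩

lemma boundaryExt_eq_zero_iff (i : ℕ) {φ : boundaries P i →ₗ[R] Y} :
    boundaryExt P Y i φ = 0 ↔
      ∃ ψ : P.complex.X i →ₗ[R] Y, ψ ∘ₗ (boundaries P i).subtype = φ := by
  refine (P.extMk_eq_zero_iff _ _ rfl (d_comp_toBoundaries P Y i φ) _ rfl).trans
    ⟨fun ⟨g, hg⟩ => ⟨g.hom, ?_⟩, fun ⟨ψ, hψ⟩ => ⟨ModuleCat.ofHom ψ, ?_⟩⟩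
  · refine (LinearMap.cancel_right (toBoundaries_surjective P i)).1 ?_
    exact ModuleCat.hom_ext_iff.1 hg
  · subst hψ
    rfl

lemma boundaryExt_comp (i : ℕ) (φ : boundaries P i →ₗ[R] Y) (g : Y ⟶ Y) :
    boundaryExt P Y i (g.hom ∘ₗ φ) =
      (boundaryExt P Y i φ).comp (Abelian.Ext.mk₀ g) (add_zero _) :=
  (P.extMk_comp_mk₀ _ _ rfl (d_comp_toBoundaries P Y i φ) g).symm

lemma projective_boundaries {d m : ℕ} (hfin : ∀ i, Module.Finite R (P.complex.X i))
    (hm : ∀ i, m < i → Limits.IsZero (P.complex.X i))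
    (hE : ∀ i, d < i → Subsingleton (Abelian.Ext X (ModuleCat.of R R) i)) {i : ℕ}
    (hi : d ≤ i + 1) : Module.Projective R (boundaries P i) := by
  by_cases him : m ≤ i
  · have := ModuleCat.subsingleton_of_isZero (hm (i + 1) (by lia))
    have := (toBoundaries_surjective P i).subsingleton
    infer_instance
  · have := projective_boundaries hfin hm hE (i := i + 1) (by lia)
    have := finite_boundaries P (i + 1)
    have := hE (i + 2) (by lia)
    refine projective_of_functionals_extend (i := (boundaries P (i + 1)).subtype)
      (exact_subtype_toBoundaries P i) (toBoundaries_surjective P i) fun φ => ?_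
    exact (boundaryExt_eq_zero_iff P (ModuleCat.of R R) (i + 1)).1 (Subsingleton.elim _ _)
termination_by m - i

end Boundaries

/-! ### Spaces of homomorphisms into a finite-dimensional module -/

section HomDimension

variable {R k : Type*} [Ring R] [Field k] {P Q X N : Type*} [AddCommGroup P] [Module R P]
  [AddCommGroup Q] [Module R Q] [AddCommGroup X] [Module R X]
  [AddCommGroup N] [Module R N] [Module k N] [SMulCommClass R k N]

instance finiteDimensional_hom [Module.Finite R P] [FiniteDimensional k N] :
    FiniteDimensional k (P →ₗ[R] N) := by
  obtain ⟨r, x, hx⟩ := Module.Finite.exists_fin (R := R) (M := P)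
  exact .of_injective (LinearMap.pi fun i => LinearMap.applyₗ' k (x i)) fun _ _ h =>
    LinearMap.ext_on_range hx (congr_fun h)

variable (k) in
/-- The `k`-linear map `N → Hom(P, N)` attached to a functional `φ` on `P`, which sends `y` to
`p ↦ φ(p) y`. -/
def smulRightHom (φ : P →ₗ[R] R) : N →ₗ[k] (P →ₗ[R] N) where
  toFun y := φ.smulRight y
  map_add' y z := by ext; simp
  map_smul' c y := by ext; simp [smul_comm]

@[simp]
lemma smulRightHom_apply (φ : P →ₗ[R] R) (y : N) (p : P) : smulRightHom k φ y p = φ p • y := rfl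

lemma sum_smulRightHom {r : ℕ} {x : Fin r → P} {φ : Fin r → P →ₗ[R] R}
    (hx : ∀ p, ∑ i, φ i p • x i = p) (h : P →ₗ[R] N) :
    ∑ i, smulRightHom k (φ i) (h (x i)) = h := by
  ext p
  conv_rhs => rw [← hx p]
  simp [LinearMap.sum_apply]

lemma finrank_hom_add_finrank_range_lcomp [Module.Finite R Q] [FiniteDimensional k N]
    {i : P →ₗ[R] Q} {q : Q →ₗ[R] X} (hiq : Function.Exact i q) (hq : Function.Surjective q) :
    Module.finrank k (X →ₗ[R] N) + Module.finrank k (LinearMap.range (LinearMap.lcomp k N i)) =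
      Module.finrank k (Q →ₗ[R] N) := by
  have hker : LinearMap.range (LinearMap.lcomp k N q) = LinearMap.ker (LinearMap.lcomp k N i) := by
    refine le_antisymm ?_ fun h hh => exists_comp_eq_of_ker_le hq ?_
    · rintro _ ⟨g, rfl⟩
      exact LinearMap.ext fun p => by simp [hiq.apply_apply_eq_zero]
    · rw [LinearMap.exact_iff.1 hiq]
      exact LinearMap.range_le_ker_iff.2 hh
  rw [← LinearMap.finrank_range_add_finrank_ker (LinearMap.lcomp k N i), ← hker,
    LinearMap.finrank_range_of_inj (LinearMap.lcomp_injective_of_surjective q hq), add_comm]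

lemma finrank_hom_ker_add_finrank_hom [Module.Finite R P] [Module.Projective R P]
    [Module.Finite R Q] [Module.Projective R Q] [FiniteDimensional k N] {p : P →ₗ[R] X}
    {q : Q →ₗ[R] X} (hp : Function.Surjective p) (hq : Function.Surjective q)
    [Module.Finite R (LinearMap.ker p)] :
    Module.finrank k (LinearMap.ker p →ₗ[R] N) + Module.finrank k (Q →ₗ[R] N) =
      Module.finrank k (LinearMap.ker q →ₗ[R] N) + Module.finrank k (P →ₗ[R] N) := by
  obtain ⟨e⟩ := exists_schanuel_equiv hp hq
  have : Module.Finite R (LinearMap.ker q) :=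
    .of_surjective (LinearMap.fst R _ P ∘ₗ e.toLinearMap) (Prod.fst_surjective.comp e.surjective)
  rw [← Module.finrank_prod, ← Module.finrank_prod]
  exact ((LinearMap.coprodEquiv k).trans
    ((e.congrLeft N k).trans (LinearMap.coprodEquiv k).symm)).finrank_eq

end HomDimension

section DetRetract

open Polynomial

lemma map_det_one_add_smul_map_C {R S ι : Type*} [CommRing R] [CommRing S] [Fintype ι]
    [DecidableEq ι] (f : R →+* S) (B : Matrix ι ι R) :
    (1 + (X - 1 : R[X]) • B.map C).det.map f = (1 + (X - 1 : S[X]) • (B.map f).map C).det := by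
  refine ((mapRingHom f).map_det _).trans (congr_arg Matrix.det ?_)
  ext1 s t
  simp [Matrix.one_apply, apply_ite]

variable {k V W ι : Type*} [Field k] [AddCommGroup V] [Module k V] [AddCommGroup W] [Module k W]
  [FiniteDimensional k W] [Fintype ι] [DecidableEq ι]

lemma det_one_add_smul_toMatrix_comp (b : Module.Basis ι k V) {i : W →ₗ[k] V} {p : V →ₗ[k] W}
    (hpi : p ∘ₗ i = LinearMap.id) :
    (1 + (X - 1 : k[X]) • (LinearMap.toMatrix b b (i ∘ₗ p)).map C).det =
      X ^ Module.finrank k W := by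
  let w := Module.finBasis k W
  have hcomp : LinearMap.toMatrix b b (i ∘ₗ p) =
      LinearMap.toMatrix w b i * LinearMap.toMatrix b w p := LinearMap.toMatrix_comp b w b i p
  have hone : LinearMap.toMatrix b w p * LinearMap.toMatrix w b i = 1 := by
    rw [← LinearMap.toMatrix_comp, hpi, LinearMap.toMatrix_id]
  rw [hcomp, Matrix.map_mul, ← Matrix.smul_mul, Matrix.det_one_add_mul_comm, Matrix.mul_smul,
    ← Matrix.map_mul, hone, Matrix.map_one _ C_0 C_1]
  rw [sub_smul, one_smul, add_sub_cancel, Matrix.det_smul, Matrix.det_one, mul_one,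
    Fintype.card_fin]

variable {R P N : Type*} [Ring R] [AddCommGroup P] [Module R P] [AddCommGroup N]
  [Module R N] [Module k N] [SMulCommClass R k N]

/-- Evaluation at the `xᵢ` embeds `Hom(P, N)` into `N^r` as a retract, and the corresponding
projector of `N^r` is the block matrix of the actions of the ring elements `φⱼ(xᵢ)`. -/
lemma det_one_add_smul_repr_dualBasis {r : ℕ} {x : Fin r → P} {φ : Fin r → P →ₗ[R] R}
    (hx : ∀ p, ∑ i, φ i p • x i = p) (b : Module.Basis ι k N) :
    (1 + (X - 1 : k[X]) • (Matrix.of fun s t : (_ : Fin r) × ι =>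
      b.repr (φ t.1 (x s.1) • b t.2) s.2).map C).det = X ^ Module.finrank k (P →ₗ[R] N) := by
  have : FiniteDimensional k N := b.finiteDimensional_of_finite
  let ev : (P →ₗ[R] N) →ₗ[k] (Fin r → N) := LinearMap.pi fun i => LinearMap.applyₗ' k (x i)
  let pr : (Fin r → N) →ₗ[k] (P →ₗ[R] N) := ∑ j, smulRightHom k (φ j) ∘ₗ LinearMap.proj j
  have hpr : pr ∘ₗ ev = LinearMap.id :=
    LinearMap.ext fun h => by simpa [pr, ev] using sum_smulRightHom hx h
  have : FiniteDimensional k (P →ₗ[R] N) :=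
    .of_injective ev (LinearMap.injective_of_comp_eq_id ev pr hpr)
  rw [← det_one_add_smul_toMatrix_comp (Pi.basis fun _ => b) hpr]
  congr 4
  ext1 s t
  have hblock (y : N) : pr (Pi.single t.1 y) = smulRightHom k (φ t.1) y := by
    simp only [pr, LinearMap.sum_apply, LinearMap.comp_apply, LinearMap.proj_apply]
    refine (Finset.sum_eq_single_of_mem t.1 (Finset.mem_univ _) fun j _ hj => ?_).trans ?_
    · rw [Pi.single_eq_of_ne hj, map_zero]
    · rw [Pi.single_eq_same]
  simp [LinearMap.toMatrix_apply, hblock, ev]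

end DetRetract

/-! ### Modules over the enveloping algebra -/

section Env

variable {k A : Type u} [Field k] [Ring A] [Algebra k A]

@[elab_as_elim]
lemma env_induction {motive : Env k A → Prop} (s : Env k A) (zero : motive 0)
    (tmul : ∀ a b, motive (a ⊗ₜ MulOpposite.op b))
    (add : ∀ s t, motive s → motive t → motive (s + t)) : motive s :=
  TensorProduct.induction_on s zero (fun a b => tmul a b.unop) add

/-- `zero_smul` fails to unify its zero with that of the tensor product at reducible
transparency, so that `simp` and `rw` need this instance of it. -/
@[simp]
lemma env_zero_smul {N : Type*} [AddCommGroup N] [Module (Env k A) N] (y : N) :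
    (0 : Env k A) • y = 0 :=
  zero_smul (Env k A) y

end Env

/-! ### Local constancy on the representation scheme -/

section LocallyConstant

open Polynomial

variable {k A : Type u} [Field k] [Ring A] [Algebra k A] {n : ℕ}

lemma classify_univRep {B : Type*} [CommRing B] [Algebra k B]
    (ρ : A →ₐ[k] Matrix (Fin n) (Fin n) B) (a : A) (i j : Fin n) :
    classify ρ (univRep k A n a i j) = ρ a i j :=
  classify_mk_X ρ (a, i, j)

namespace RepPt

variable (M : RepPt k A n)

/-- The `k`-point `M` as a homomorphism from `A` to matrices. -/
def mat : A →ₐ[k] Matrix (Fin n) (Fin n) k := M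

/-- The value of a regular function at the `k`-point `M`. -/
def evalAt : RepRing k A n →ₐ[k] k := classify M.mat

lemma evalAt_univRep (a : A) (i j : Fin n) : M.evalAt (univRep k A n a i j) = M.mat a i j :=
  classify_univRep M.mat a i j

/-- The identification of matrices with endomorphisms of `M`. -/
def matEquiv : Matrix (Fin n) (Fin n) k ≃ₐ[k] Module.End k M.Mod :=
  Matrix.toLinAlgEquiv' (R := k) (n := Fin n)

lemma matEquiv_mat (a : A) : M.matEquiv (M.mat a) = M.toEnd a := rfl

instance : FiniteDimensional k M.Mod := inferInstanceAs (FiniteDimensional k (Fin n → k))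

instance : IsScalarTower k (Env k A) (Module.End k M.Mod) where
  smul_assoc c s f := by simp [env_smul_def]

lemma tmul_smul (a b : A) (f : Module.End k M.Mod) :
    (a ⊗ₜ[k] MulOpposite.op b : Env k A) • f = M.toEnd a * f * M.toEnd b :=
  LinearMap.ext fun v => M.tmul_smul_apply a b f v

/-- The basis of `End_k(M)` given by the matrix units. -/
def endBasis : Module.Basis (Fin n × Fin n) k (Module.End k M.Mod) :=
  (Matrix.stdBasis k (Fin n) (Fin n)).map M.matEquiv.toLinearEquiv

lemma endBasis_apply (x : Fin n × Fin n) :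
    M.endBasis x = M.matEquiv (Matrix.single x.1 x.2 1) := by
  rw [endBasis, Module.Basis.map_apply, Matrix.stdBasis_eq_single]
  rfl

lemma endBasis_repr_matEquiv (X : Matrix (Fin n) (Fin n) k) (x : Fin n × Fin n) :
    M.endBasis.repr (M.matEquiv X) x = X x.1 x.2 := by
  have hsymm : M.matEquiv.toLinearEquiv.symm (M.matEquiv X) = X := M.matEquiv.symm_apply_apply X
  rw [endBasis, Module.Basis.map_repr, LinearEquiv.trans_apply, hsymm]
  simp [Matrix.stdBasis]

end RepPt

variable (k A n) in
/-- The matrix of regular functions giving the action of an element of `Aᵉ` on `End_k(M)` in the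
basis of matrix units. -/
def envMat : Env k A →ₗ[k] Matrix (Fin n × Fin n) (Fin n × Fin n) (RepRing k A n) :=
  TensorProduct.lift <| Matrix.kroneckerBilinear.compl₁₂ (univRep k A n).toLinearMap
    ((Matrix.transposeLinearEquiv (Fin n) (Fin n) k (RepRing k A n)).toLinearMap ∘ₗ
      (univRep k A n).toLinearMap ∘ₗ (MulOpposite.opLinearEquiv k).symm.toLinearMap)

lemma RepPt.evalAt_envMat (M : RepPt k A n) (s : Env k A) (x y : Fin n × Fin n) :
    M.evalAt (envMat k A n s x y) = M.endBasis.repr (s • M.endBasis y) x := by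
  induction s using env_induction with
  | zero => simp
  | add s t hs ht => simp [add_smul, hs, ht]
  | tmul a b =>
    have hkron : envMat k A n (a ⊗ₜ MulOpposite.op b) x y =
        univRep k A n a x.1 y.1 * univRep k A n b y.2 x.2 := rfl
    rw [hkron, map_mul, M.evalAt_univRep, M.evalAt_univRep, M.tmul_smul, M.endBasis_apply,
      ← M.matEquiv_mat, ← M.matEquiv_mat, ← map_mul, ← map_mul, M.endBasis_repr_matEquiv]
    simp [Matrix.mul_apply, Matrix.single, ite_and]

lemma isLocallyConstant_of_map_evalAt_eq_X_pow {g : RepPt k A n → ℕ} (p : (RepRing k A n)[X])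
    (hp : ∀ M : RepPt k A n, p.map (M.evalAt : RepRing k A n →+* k) = X ^ g M) :
    IsLocallyConstant g := by
  refine IsLocallyConstant.iff_isOpen_fiber.2 fun c => ?_
  have hfiber : g ⁻¹' {c} = (RepPt.toSpec ⁻¹' PrimeSpectrum.zeroLocus {p.coeff c})ᶜ := by
    ext M
    have hmem : M.evalAt (p.coeff c) = if c = g M then 1 else 0 := by
      rw [← coeff_X_pow, ← hp, coeff_map]
      rfl
    have hzero : M.toSpec ∈ PrimeSpectrum.zeroLocus {p.coeff c} ↔ M.evalAt (p.coeff c) = 0 :=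
      Set.singleton_subset_iff
    refine Iff.trans ?_ (not_congr hzero).symm
    rw [hmem]
    simp [eq_comm (a := c)]
  rw [hfiber]
  exact ((PrimeSpectrum.isClosed_zeroLocus _).preimage continuous_induced_dom).isOpen_compl

lemma isLocallyConstant_finrank_hom (n : ℕ) (P : Type*) [AddCommGroup P]
    [Module (Env k A) P] [Module.Finite (Env k A) P] [Module.Projective (Env k A) P] :
    IsLocallyConstant fun M : RepPt k A n =>
      Module.finrank k (P →ₗ[Env k A] Module.End k M.Mod) := by
  obtain ⟨r, x, φ, hx⟩ := exists_finite_dualBasis (Env k A) P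
  refine isLocallyConstant_of_map_evalAt_eq_X_pow
    (1 + (X - 1 : (RepRing k A n)[X]) • (Matrix.of fun s t : (_ : Fin r) × (Fin n × Fin n) =>
      envMat k A n (φ t.1 (x s.1)) s.2 t.2).map C).det fun M => ?_
  rw [← det_one_add_smul_repr_dualBasis hx M.endBasis]
  refine (map_det_one_add_smul_map_C _ _).trans ?_
  congr 4
  ext1 s t
  exact M.evalAt_envMat _ _ _

end LocallyConstant

/-! ### Derivations and the kernel of the multiplication -/

section Derivations

variable {k A : Type u} [Field k] [Ring A] [Algebra k A]

variable (k A) in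
/-- The multiplication map `Aᵉ → A` as a map of bimodules. -/
def envMul : Env k A →ₗ[Env k A] diagBimod k A :=
  LinearMap.toSpanSingleton (Env k A) (diagBimod k A) (show diagBimod k A from (1 : A))

/-- The multiplication map `Aᵉ → A` with values in the ring `A`, so that they can be multiplied. -/
def envVal : Env k A →+ A := (envMul k A).toAddMonoidHom

lemma envVal_tmul (a b : A) : envVal (k := k) (a ⊗ₜ MulOpposite.op b) = a * b :=
  (diagBimod_smul k A a b 1).trans (by rw [mul_one])

lemma envMul_surjective : Function.Surjective (envMul k A) := fun a =>
  ⟨(show A from a) ⊗ₜ MulOpposite.op 1, (envVal_tmul (k := k) (show A from a) 1).trans (mul_one _)⟩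

lemma mem_ker_envMul {s : Env k A} : s ∈ LinearMap.ker (envMul k A) ↔ envVal s = 0 := Iff.rfl

variable (k) in
/-- The noncommutative differential `da = a ⊗ 1 - 1 ⊗ a`. -/
def ncDiff (a : A) : LinearMap.ker (envMul k A) :=
  ⟨a ⊗ₜ MulOpposite.op 1 - 1 ⊗ₜ MulOpposite.op a, by
    rw [mem_ker_envMul, map_sub, envVal_tmul, envVal_tmul, mul_one, one_mul, sub_self]⟩

lemma ncDiff_add (a b : A) : ncDiff k (a + b) = ncDiff k a + ncDiff k b := by
  ext
  simp only [ncDiff, Submodule.coe_add, TensorProduct.add_tmul, MulOpposite.op_add,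
    TensorProduct.tmul_add]
  abel

lemma ncDiff_smul (c : k) (a : A) : ncDiff k (c • a) = algebraMap k (Env k A) c • ncDiff k a := by
  ext
  simp only [ncDiff, Submodule.coe_smul, ← Algebra.smul_def, smul_sub, smul_eq_mul,
    TensorProduct.smul_tmul', MulOpposite.op_smul, TensorProduct.tmul_smul]

lemma ncDiff_mul (a b : A) : ncDiff k (a * b) =
    (a ⊗ₜ[k] MulOpposite.op (1 : A) : Env k A) • ncDiff k b +
      ((1 : A) ⊗ₜ[k] MulOpposite.op b : Env k A) • ncDiff k a := by
  ext
  simp [ncDiff, mul_sub, ← MulOpposite.op_mul]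

/-- On pure tensors: `a ⊗ b = ab ⊗ 1 - a db`. -/
lemma sub_envVal_tmul_mem_span_ncDiff (s : Env k A) :
    s - envVal s ⊗ₜ MulOpposite.op (1 : A) ∈
      Submodule.span (Env k A) (Set.range fun a : A => (ncDiff k a : Env k A)) := by
  induction s using env_induction with
  | zero => simp
  | add s t hs ht =>
    rw [map_add, TensorProduct.add_tmul, add_sub_add_comm]
    exact add_mem hs ht
  | tmul a b =>
    have h : (a ⊗ₜ MulOpposite.op b : Env k A) - (a * b) ⊗ₜ MulOpposite.op (1 : A) =
        -((a ⊗ₜ MulOpposite.op (1 : A) : Env k A) • (ncDiff k b : Env k A)) := by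
      simp [ncDiff, mul_sub]
    rw [envVal_tmul, h]
    exact neg_mem (Submodule.smul_mem _ _ (Submodule.subset_span ⟨b, rfl⟩))

lemma span_ncDiff : Submodule.span (Env k A) (Set.range (ncDiff k (A := A))) = ⊤ := by
  refine Submodule.map_injective_of_injective (LinearMap.ker (envMul k A)).injective_subtype
    (le_antisymm (Submodule.map_mono le_top) ?_)
  rintro _ ⟨x, -, rfl⟩
  have h := sub_envVal_tmul_mem_span_ncDiff (x : Env k A)
  rw [mem_ker_envMul.1 x.2, TensorProduct.zero_tmul, sub_zero] at h
  rwa [Submodule.map_span, ← Set.range_comp]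

variable {N : Type*} [AddCommGroup N] [Module k N] [Module (Env k A) N]
  [IsScalarTower k (Env k A) N]

variable (k A N) in
/-- Derivations of `A` with values in the bimodule `N`. -/
def bimodDer : Submodule k (A →ₗ[k] N) where
  carrier := {δ | ∀ a b : A, δ (a * b) =
    (a ⊗ₜ[k] MulOpposite.op (1 : A) : Env k A) • δ b +
      ((1 : A) ⊗ₜ[k] MulOpposite.op b : Env k A) • δ a}
  add_mem' {δ ε} hδ hε a b := by
    simp only [LinearMap.add_apply, hδ a b, hε a b, smul_add]
    abel
  zero_mem' a b := by simp
  smul_mem' c δ hδ a b := by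
    simp only [LinearMap.smul_apply, hδ a b, smul_add, smul_comm c]

lemma bimodDer_map_one {δ : A →ₗ[k] N} (hδ : δ ∈ bimodDer k A N) : δ 1 = 0 := by
  simpa [← Algebra.TensorProduct.one_def] using hδ 1 1

/-- The derivation attached to a bimodule map `Ω → N`, where `Ω` is the kernel of `Aᵉ → A`. -/
def derOfHom : (LinearMap.ker (envMul k A) →ₗ[Env k A] N) →ₗ[k] bimodDer k A N where
  toFun h :=
    ⟨{ toFun a := h (ncDiff k a)
       map_add' a b := by rw [ncDiff_add, map_add]
       map_smul' c a := by rw [ncDiff_smul, map_smul, algebraMap_smul, RingHom.id_apply] },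
     fun a b => by
      change h _ = _ • h _ + _ • h _
      rw [ncDiff_mul, map_add, map_smul, map_smul]⟩
  map_add' _ _ := rfl
  map_smul' _ _ := rfl

/-- The `k`-linear map `Aᵉ → N`, `a ⊗ b ↦ -a δ(b)`. -/
def extDer (δ : A →ₗ[k] N) : Env k A →ₗ[k] N :=
  TensorProduct.lift <| LinearMap.mk₂ k
    (fun (a : A) (b : Aᵐᵒᵖ) => -((a ⊗ₜ[k] MulOpposite.op (1 : A) : Env k A) • δ b.unop))
    (fun a a' b => by simp [TensorProduct.add_tmul, add_smul, add_comm])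
    (fun c a b => by simp [← TensorProduct.smul_tmul'])
    (fun a b b' => by simp [add_comm])
    (fun c a b => by simp [smul_comm _ c])

lemma extDer_tmul (δ : A →ₗ[k] N) (a b : A) : extDer δ (a ⊗ₜ MulOpposite.op b) =
    -((a ⊗ₜ[k] MulOpposite.op (1 : A) : Env k A) • δ b) := rfl

lemma extDer_tmul_mul {δ : A →ₗ[k] N} (hδ : δ ∈ bimodDer k A N) (a b : A) (s : Env k A) :
    extDer δ ((a ⊗ₜ MulOpposite.op b) * s) =
      (a ⊗ₜ[k] MulOpposite.op b : Env k A) • extDer δ s -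
      ((a * envVal s) ⊗ₜ[k] MulOpposite.op (1 : A) : Env k A) • δ b := by
  induction s using env_induction with
  | zero => simp
  | add s t hs ht =>
    rw [mul_add, map_add, hs, ht, map_add, map_add, mul_add, TensorProduct.add_tmul, add_smul,
      smul_add]
    abel
  | tmul c d =>
    rw [envVal_tmul, Algebra.TensorProduct.tmul_mul_tmul, ← MulOpposite.op_mul, extDer_tmul,
      extDer_tmul, hδ d b, smul_add, smul_neg, smul_smul, smul_smul, smul_smul]
    simp only [Algebra.TensorProduct.tmul_mul_tmul, ← MulOpposite.op_mul, mul_one, one_mul,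
      mul_assoc]
    abel

lemma extDer_mul {δ : A →ₗ[k] N} (hδ : δ ∈ bimodDer k A N) (s : Env k A) {x : Env k A}
    (hx : envVal x = 0) : extDer δ (s * x) = s • extDer δ x := by
  induction s using env_induction with
  | zero => simp
  | add s t hs ht => rw [add_mul, map_add, hs, ht, add_smul]
  | tmul a b =>
    rw [extDer_tmul_mul hδ, hx, mul_zero, TensorProduct.zero_tmul, env_zero_smul, sub_zero]

/-- The bimodule map `Ω → N` attached to a derivation. -/
def homOfDer (δ : bimodDer k A N) : LinearMap.ker (envMul k A) →ₗ[Env k A] N where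
  toFun x := extDer δ.1 x
  map_add' _ _ := map_add _ _ _
  map_smul' s x := extDer_mul δ.2 s x.2

lemma derOfHom_bijective : Function.Bijective (derOfHom (k := k) (A := A) (N := N)) := by
  refine ⟨fun h h' e => LinearMap.ext_on_range span_ncDiff fun a =>
    LinearMap.congr_fun (congr_arg Subtype.val e) a, fun δ => ⟨homOfDer δ, ?_⟩⟩
  ext a
  change extDer δ.1 (a ⊗ₜ MulOpposite.op 1 - 1 ⊗ₜ MulOpposite.op a) = _
  rw [map_sub, extDer_tmul, extDer_tmul, bimodDer_map_one δ.2, smul_zero, neg_zero, zero_sub,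
    neg_neg, MulOpposite.op_one, ← Algebra.TensorProduct.one_def, one_smul]

end Derivations

/-! ### Tangent vectors as derivations -/

section PointDerivations

variable {k R : Type*} [Field k] [CommRing R] [Algebra k R] (ε : R →ₐ[k] k)

/-- The derivations of `R` with values in the residue field at the `k`-point `ε` of `Spec R`. -/
def pointDer : Submodule k (R →ₗ[k] k) where
  carrier := {D | ∀ v w, D (v * w) = ε v * D w + ε w * D v}
  add_mem' {D E} hD hE v w := by
    simp only [LinearMap.add_apply, hD v w, hE v w]
    ring
  zero_mem' v w := by simp
  smul_mem' c D hD v w := by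
    simp only [LinearMap.smul_apply, hD v w, smul_eq_mul]
    ring

variable {ε} in
lemma pointDer_algebraMap {D : R →ₗ[k] k} (hD : D ∈ pointDer ε) (c : k) :
    D (algebraMap k R c) = 0 := by
  have h1 : D 1 = 0 := by simpa using hD 1 1
  rw [Algebra.algebraMap_eq_smul_one, map_smul, h1, smul_zero]

/-- The retraction `v ↦ v - ε(v)` of `R` onto the maximal ideal of the `k`-point `ε`. -/
def kerRetraction : R →ₗ[k] RingHom.ker ε where
  toFun v := ⟨v - algebraMap k R (ε v), by simp [RingHom.mem_ker]⟩
  map_add' v w := by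
    ext
    simp only [map_add, Submodule.coe_add]
    ring
  map_smul' c v := by
    ext
    simp [Algebra.smul_def, mul_sub]

lemma kerRetraction_coe (v : RingHom.ker ε) : kerRetraction ε v = v := by
  ext
  simp [kerRetraction, RingHom.mem_ker.1 v.2]

/-- The differential at `ε`, with values in the cotangent space. -/
def cotangentDiff : R →ₗ[k] (RingHom.ker ε).Cotangent :=
  (RingHom.ker ε).toCotangent.restrictScalars k ∘ₗ kerRetraction ε

lemma cotangentDiff_mul (v w : R) :
    cotangentDiff ε (v * w) = ε v • cotangentDiff ε w + ε w • cotangentDiff ε v := by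
  change Ideal.toCotangent _ (kerRetraction ε (v * w)) =
    Ideal.toCotangent _ (ε v • kerRetraction ε w + ε w • kerRetraction ε v)
  rw [Ideal.toCotangent_eq, pow_two]
  convert Ideal.mul_mem_mul (kerRetraction ε v).2 (kerRetraction ε w).2 using 1
  simp only [kerRetraction, LinearMap.coe_mk, AddHom.coe_mk, Submodule.coe_add, map_mul,
    Submodule.coe_smul_of_tower, Algebra.smul_def]
  ring

/-- The tangent space at `ε` is the space of derivations at `ε`: a functional on the cotangent space
is composed with the differential. -/
def cotangentDualEquiv : Module.Dual k (RingHom.ker ε).Cotangent ≃ₗ[k] pointDer ε where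
  toFun ψ := ⟨ψ ∘ₗ cotangentDiff ε, fun v w => by
    simp only [LinearMap.comp_apply, cotangentDiff_mul, map_add, map_smul, smul_eq_mul]⟩
  map_add' _ _ := rfl
  map_smul' _ _ := rfl
  invFun D := Ideal.Cotangent.lift (D.1 ∘ₗ ((RingHom.ker ε).subtype.restrictScalars k))
    fun x y => by
      have h := D.2 x y
      rwa [RingHom.mem_ker.1 x.2, RingHom.mem_ker.1 y.2, zero_mul, zero_mul, add_zero] at h
  left_inv ψ := by
    ext c
    obtain ⟨v, rfl⟩ := Ideal.toCotangent_surjective _ c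
    exact congr_arg (fun w => ψ (Ideal.toCotangent _ w)) (kerRetraction_coe ε v)
  right_inv D := by
    ext v
    change D.1 (v - algebraMap k R (ε v)) = D.1 v
    rw [map_sub, pointDer_algebraMap D.2, sub_zero]

end PointDerivations

section Tangent

variable {k A : Type u} [Field k] [Ring A] [Algebra k A] {n : ℕ}

namespace RepPt

variable (M : RepPt k A n)

lemma pointDer_ext {D : RepRing k A n →ₗ[k] k} (hD : D ∈ pointDer M.evalAt)
    (h : ∀ a i j, D (univRep k A n a i j) = 0) : D = 0 := by
  refine LinearMap.ext fun v => ?_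
  obtain ⟨p, rfl⟩ := Ideal.Quotient.mk_surjective v
  change D (Ideal.Quotient.mk _ p) = 0
  induction p using MvPolynomial.induction_on with
  | C c => exact pointDer_algebraMap hD c
  | add p q hp hq => rw [map_add, map_add, hp, hq, add_zero]
  | mul_X p x hp =>
    have hx : D (Ideal.Quotient.mk _ (MvPolynomial.X x)) = 0 := h x.1 x.2.1 x.2.2
    rw [map_mul, hD (Ideal.Quotient.mk _ p), hp, hx, mul_zero, mul_zero, add_zero]

lemma mem_bimodDer_iff {δ : A →ₗ[k] Module.End k M.Mod} :
    δ ∈ bimodDer k A (Module.End k M.Mod) ↔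
      ∀ a b, δ (a * b) = M.toEnd a * δ b + δ a * M.toEnd b := by
  refine forall₂_congr fun a b => ?_
  rw [M.tmul_smul, M.tmul_smul, map_one, mul_one, one_mul]

/-- The derivation `A → End_k(M)` attached to a derivation of `V_n(A)` at `M`, which is applied to
the entries of the universal representation. -/
def bimodDerOfPointDer : pointDer M.evalAt →ₗ[k] bimodDer k A (Module.End k M.Mod) where
  toFun D := ⟨M.matEquiv.toLinearMap ∘ₗ D.1.mapMatrix ∘ₗ (univRep k A n).toLinearMap, by
    refine M.mem_bimodDer_iff.2 fun a b => ?_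
    change M.matEquiv _ = M.matEquiv (M.mat a) * M.matEquiv _ + M.matEquiv _ * M.matEquiv (M.mat b)
    rw [← map_mul, ← map_mul, ← map_add]
    congr 1
    ext i j
    simp only [LinearMap.comp_apply, AlgHom.toLinearMap_apply, map_mul, LinearMap.mapMatrix_apply,
      Matrix.map_apply, Matrix.mul_apply, map_sum, D.2 _ _, M.evalAt_univRep,
      Finset.sum_add_distrib, Matrix.add_apply, mul_comm]⟩
  map_add' D E := by
    ext a : 2
    exact map_add M.matEquiv _ _
  map_smul' c D := by
    ext a : 2
    exact map_smul M.matEquiv c _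

/-- The first order deformation of `M` along a derivation. -/
def deform (δ : bimodDer k A (Module.End k M.Mod)) :
    A →ₐ[k] Matrix (Fin n) (Fin n) (DualNumber k) :=
  AlgHom.ofLinearMap
    { toFun := fun a => Matrix.of fun i j =>
        (TrivSqZeroExt.inl (M.mat a i j) + TrivSqZeroExt.inr (M.matEquiv.symm (δ.1 a) i j) :
          DualNumber k)
      map_add' := fun a b => by
        ext i j <;> simp
      map_smul' := fun c a => by
        ext i j <;> simp }
    (by ext i j <;> by_cases hij : i = j <;> simp [bimodDer_map_one δ.2, hij, Matrix.one_apply])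
    (fun a b => by
      ext i j
      · simp [Matrix.mul_apply, TrivSqZeroExt.fst_sum]
      · simp [Matrix.mul_apply, TrivSqZeroExt.snd_sum, M.mem_bimodDer_iff.1 δ.2 a b,
          ← M.matEquiv_mat, Finset.sum_add_distrib, mul_comm])

lemma fst_classify_deform (δ : bimodDer k A (Module.End k M.Mod)) (v : RepRing k A n) :
    (classify (M.deform δ) v).fst = M.evalAt v := by
  suffices h : (TrivSqZeroExt.fstHom k k k).comp (classify (M.deform δ)) = M.evalAt from
    DFunLike.congr_fun h v
  refine (repEquiv k A n k).injective (AlgHom.ext fun a => ?_)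
  ext i j
  change (classify (M.deform δ) (univRep k A n a i j)).fst = M.evalAt (univRep k A n a i j)
  rw [classify_univRep, M.evalAt_univRep]
  simp [deform]

lemma bimodDerOfPointDer_bijective : Function.Bijective M.bimodDerOfPointDer := by
  refine ⟨(injective_iff_map_eq_zero _).2 fun D hD => Subtype.ext (M.pointDer_ext D.2 ?_),
    fun δ => ⟨⟨TrivSqZeroExt.sndHom k k ∘ₗ (classify (M.deform δ)).toLinearMap, fun v w => ?_⟩, ?_⟩⟩
  · intro a i j
    have h : M.matEquiv (D.1.mapMatrix (univRep k A n a)) = 0 :=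
      LinearMap.congr_fun (congr_arg Subtype.val hD) a
    exact congr_fun₂ ((map_eq_zero_iff M.matEquiv M.matEquiv.injective).1 h) i j
  · simp [fst_classify_deform, mul_comm]
  · ext a : 2
    refine (M.matEquiv.eq_symm_apply.1 ?_)
    ext i j
    change (classify (M.deform δ) (univRep k A n a i j)).snd = _
    rw [classify_univRep]
    simp [deform]

lemma finrank_tangentSpace : Module.finrank k M.TangentSpace =
    Module.finrank k (LinearMap.ker (envMul k A) →ₗ[Env k A] Module.End k M.Mod) :=
  ((cotangentDualEquiv M.evalAt).trans
    ((LinearEquiv.ofBijective _ M.bimodDerOfPointDer_bijective).trans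
      (LinearEquiv.ofBijective _ derOfHom_bijective).symm)).finrank_eq

end RepPt

end Tangent

/-! ### Duality and Hochschild homology in degree zero -/

section Coinvariants

variable (k A : Type u) [Field k] [Ring A] [Algebra k A]
variable (N : Type*) [AddCommGroup N] [Module k N] [Module (Env k A) N]

/-- The subspace `[A, N]` of a bimodule `N`, spanned by the commutators `a y - y a`. -/
def commutatorSpace : Submodule k N :=
  Submodule.span k {x | ∃ (a : A) (y : N), x = (ncDiff k a : Env k A) • y}

/-- The Hochschild homology `HH₀(A, N) = N / [A, N]`. -/
abbrev HochschildZero : Type _ := N ⧸ commutatorSpace k A N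

variable {k A N} [SMulCommClass (Env k A) k N]

/-- The map `y ↦ [a y]` from `N` to `HH₀(A, N)`. -/
def leftClass (a : A) : N →ₗ[k] HochschildZero k A N :=
  (commutatorSpace k A N).mkQ ∘ₗ
    DistribSMul.toLinearMap k N (a ⊗ₜ MulOpposite.op 1 : Env k A)

lemma leftClass_apply (a : A) (y : N) : leftClass a y =
    (commutatorSpace k A N).mkQ ((a ⊗ₜ MulOpposite.op 1 : Env k A) • y) := rfl

lemma leftClass_one (y : N) : leftClass (1 : A) y = (commutatorSpace k A N).mkQ y := by
  rw [leftClass_apply, MulOpposite.op_one, ← Algebra.TensorProduct.one_def, one_smul]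

lemma leftClass_zero : leftClass (0 : A) = (0 : N →ₗ[k] HochschildZero k A N) := by
  ext y
  simp [leftClass_apply, TensorProduct.zero_tmul]

lemma leftClass_add (a b : A) : leftClass (a + b) = (leftClass a + leftClass b : N →ₗ[k] _) := by
  ext y
  simp only [leftClass_apply, TensorProduct.add_tmul, add_smul, map_add, LinearMap.add_apply]

lemma leftClass_tmul_smul (a b c : A) (y : N) :
    leftClass (k := k) a ((b ⊗ₜ MulOpposite.op c : Env k A) • y) = leftClass (c * a * b) y := by
  rw [leftClass_apply, leftClass_apply, eq_comm, ← sub_eq_zero, ← map_sub,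
    Submodule.mkQ_apply, Submodule.Quotient.mk_eq_zero]
  refine Submodule.subset_span ⟨c, ((a * b) ⊗ₜ MulOpposite.op 1 : Env k A) • y, ?_⟩
  simp only [ncDiff, smul_smul, sub_mul, sub_smul, Algebra.TensorProduct.tmul_mul_tmul, mul_assoc,
    one_mul, mul_one, MulOpposite.op_one]

end Coinvariants

section DualCokernel

variable {k A : Type u} [Field k] [Ring A] [Algebra k A]
variable {P Q N : Type*} [AddCommGroup P] [Module (Env k A) P] [AddCommGroup Q]
  [Module (Env k A) Q] [AddCommGroup N] [Module k N] [Module (Env k A) N]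
  [SMulCommClass (Env k A) k N]

/-- The map `e` identifies `A` with the cokernel of `Hom(Q, Aᵉ) → Hom(P, Aᵉ)`, as a bimodule. The
bimodule structure of `Hom(P, Aᵉ)` is induced by the right multiplications of `Aᵉ`. -/
structure IsDualCokernel (i : P →ₗ[Env k A] Q) (e : (P →ₗ[Env k A] Env k A) →+ A) : Prop where
  surjective : Function.Surjective e
  eq_zero_iff : ∀ ξ, e ξ = 0 ↔ ∃ ψ : Q →ₗ[Env k A] Env k A, ψ ∘ₗ i = ξ
  map_rightMul : ∀ (a b : A) (ξ : P →ₗ[Env k A] Env k A),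
    e ((envRightMul k A (a ⊗ₜ MulOpposite.op b)).hom ∘ₗ ξ) = b * e ξ * a

lemma smulRightHom_rightMul (ξ : P →ₗ[Env k A] Env k A) (s : Env k A) (y : N) :
    smulRightHom k ((envRightMul k A s).hom ∘ₗ ξ) y = smulRightHom k ξ (s • y) :=
  LinearMap.ext fun p => mul_smul (ξ p) s y

namespace IsDualCokernel

variable {i : P →ₗ[Env k A] Q} {e : (P →ₗ[Env k A] Env k A) →+ A} (he : IsDualCokernel i e)
include he

lemma leftClass_smul (ξ : P →ₗ[Env k A] Env k A) (s : Env k A) (y : N) :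
    leftClass (k := k) (e ξ) (s • y) = leftClass (e ((envRightMul k A s).hom ∘ₗ ξ)) y := by
  induction s using env_induction with
  | zero =>
    have h : (envRightMul k A 0).hom ∘ₗ ξ = 0 := LinearMap.ext fun p => mul_zero (ξ p)
    rw [h, map_zero, leftClass_zero, env_zero_smul, map_zero, LinearMap.zero_apply]
  | tmul a b => rw [he.map_rightMul, leftClass_tmul_smul]
  | add s t hs ht =>
    have h : (envRightMul k A (s + t)).hom ∘ₗ ξ =
        (envRightMul k A s).hom ∘ₗ ξ + (envRightMul k A t).hom ∘ₗ ξ :=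
      LinearMap.ext fun p => mul_add (ξ p) s t
    rw [h, map_add, leftClass_add, add_smul, map_add, hs, ht, LinearMap.add_apply]

lemma smulRightHom_sub_mem_range {ξ ξ' : P →ₗ[Env k A] Env k A} (h : e ξ = e ξ') (y : N) :
    smulRightHom k ξ y - smulRightHom k ξ' y ∈ LinearMap.range (LinearMap.lcomp k N i) := by
  obtain ⟨ψ, hψ⟩ := (he.eq_zero_iff (ξ - ξ')).1 ((map_sub e ξ ξ').trans (by rw [h, sub_self]))
  refine ⟨smulRightHom k ψ y, LinearMap.ext fun p => ?_⟩
  change ψ (i p) • y = ξ p • y - ξ' p • y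
  rw [← sub_smul, ← LinearMap.sub_apply, ← hψ, LinearMap.comp_apply]

end IsDualCokernel

/-- The map `Hom(P, N) → HH₀(A, N)` induced by `e` and the isomorphism of `Hom(P, N)` with
`Hom(P, Aᵉ) ⊗ N` over `Aᵉ` which the dual basis `x`, `φ` of `P` provides. -/
def contractHom {r : ℕ} (x : Fin r → P) (φ : Fin r → P →ₗ[Env k A] Env k A)
    (e : (P →ₗ[Env k A] Env k A) →+ A) : (P →ₗ[Env k A] N) →ₗ[k] HochschildZero k A N :=
  ∑ j, leftClass (e (φ j)) ∘ₗ LinearMap.applyₗ' k (x j)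

lemma contractHom_apply {r : ℕ} (x : Fin r → P) (φ : Fin r → P →ₗ[Env k A] Env k A)
    (e : (P →ₗ[Env k A] Env k A) →+ A) (h : P →ₗ[Env k A] N) :
    contractHom (k := k) x φ e h = ∑ j, leftClass (e (φ j)) (h (x j)) :=
  LinearMap.sum_apply _ _ _

namespace IsDualCokernel

variable {i : P →ₗ[Env k A] Q} {e : (P →ₗ[Env k A] Env k A) →+ A} (he : IsDualCokernel i e)
  {r : ℕ} {x : Fin r → P} {φ : Fin r → P →ₗ[Env k A] Env k A} (hx : ∀ p, ∑ j, φ j p • x j = p)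
include he hx

lemma contractHom_smulRightHom (ξ : P →ₗ[Env k A] Env k A) (y : N) :
    contractHom x φ e (smulRightHom k ξ y) = leftClass (e ξ) y := by
  have hξ : ∑ j, (envRightMul k A (ξ (x j))).hom ∘ₗ φ j = ξ := by
    ext p
    conv_rhs => rw [← hx p, map_sum]
    rw [LinearMap.sum_apply]
    exact Finset.sum_congr rfl fun j _ => (map_smul ξ _ _).symm
  have hadd : ∀ ξ ξ' : P →ₗ[Env k A] Env k A,
    leftClass (e (ξ + ξ')) y = leftClass (k := k) (e ξ) y + leftClass (e ξ') y := fun ξ ξ' => by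
      rw [map_add, leftClass_add, LinearMap.add_apply]
  rw [contractHom_apply]
  conv_rhs => rw [← hξ]
  refine Eq.trans (Finset.sum_congr rfl fun j _ => he.leftClass_smul (φ j) (ξ (x j)) y) ?_
  exact (map_sum (AddMonoidHom.mk' (fun ξ => leftClass (k := k) (e ξ) y) hadd) _ _).symm

lemma contractHom_surjective :
    Function.Surjective (contractHom x φ e : (P →ₗ[Env k A] N) →ₗ[k] HochschildZero k A N) :=
  fun c => by
    obtain ⟨y, rfl⟩ := (commutatorSpace k A N).mkQ_surjective c
    obtain ⟨ξ, hξ⟩ := he.surjective 1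
    exact ⟨smulRightHom k ξ y, by rw [he.contractHom_smulRightHom hx, hξ, leftClass_one]⟩

lemma range_lcomp_le_ker_contractHom [Module.Finite (Env k A) Q] [Module.Projective (Env k A) Q] :
    LinearMap.range (LinearMap.lcomp k N i) ≤ LinearMap.ker (contractHom x φ e) := by
  obtain ⟨t, z, χ, hz⟩ := exists_finite_dualBasis (R := Env k A) Q
  rintro _ ⟨h, rfl⟩
  rw [LinearMap.mem_ker, ← sum_smulRightHom (k := k) hz h, map_sum, map_sum]
  refine Finset.sum_eq_zero fun j _ => ?_
  change contractHom x φ e (smulRightHom k (χ j ∘ₗ i) (h (z j))) = 0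
  rw [he.contractHom_smulRightHom hx, (he.eq_zero_iff _).2 ⟨χ j, rfl⟩, leftClass_zero,
    LinearMap.zero_apply]

/-- If `e ξ = 1`, then modulo the range the map `y ↦ ξ(-) y` vanishes on commutators and inverts
`contractHom`. -/
lemma ker_contractHom_le_range_lcomp :
    LinearMap.ker (contractHom x φ e) ≤ LinearMap.range (LinearMap.lcomp k N i) := by
  obtain ⟨ξ, hξ⟩ := he.surjective 1
  let ρ := (LinearMap.range (LinearMap.lcomp k N i)).mkQ ∘ₗ smulRightHom k ξ
  have hρ : ∀ {s : Env k A} {η : P →ₗ[Env k A] Env k A} (y : N),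
      e ((envRightMul k A s).hom ∘ₗ ξ) = e η →
        ρ (s • y) = Submodule.mkQ _ (smulRightHom k η y) := by
    intro s η y h
    change Submodule.mkQ _ (smulRightHom k ξ (s • y)) = _
    rw [← smulRightHom_rightMul, ← sub_eq_zero, ← map_sub, Submodule.mkQ_apply,
      Submodule.Quotient.mk_eq_zero]
    exact he.smulRightHom_sub_mem_range h y
  have hcomm : commutatorSpace k A N ≤ LinearMap.ker ρ := Submodule.span_le.2 <| by
    rintro _ ⟨a, y, rfl⟩
    change ρ ((_ - _ : Env k A) • y) = 0
    rw [sub_smul, map_sub, sub_eq_zero, hρ y rfl]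
    refine (hρ y ?_).symm
    simp only [he.map_rightMul, hξ, one_mul, mul_one]
  intro h hh
  rw [LinearMap.mem_ker, contractHom_apply] at hh
  simp only [leftClass_apply, ← map_sum] at hh
  have hzero := hcomm ((Submodule.Quotient.mk_eq_zero _).1 hh)
  rw [LinearMap.mem_ker, map_sum] at hzero
  rw [← Submodule.Quotient.mk_eq_zero, ← Submodule.mkQ_apply, ← sum_smulRightHom (k := k) hx h,
    map_sum, ← hzero]
  exact Finset.sum_congr rfl fun j _ =>
    (hρ _ (by rw [he.map_rightMul, hξ, one_mul, one_mul])).symm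

omit hx in
lemma finrank_range_lcomp_add_finrank_hochschildZero [Module.Finite (Env k A) P]
    [Module.Projective (Env k A) P] [Module.Finite (Env k A) Q] [Module.Projective (Env k A) Q]
    [FiniteDimensional k N] :
    Module.finrank k (LinearMap.range (LinearMap.lcomp k N i)) +
      Module.finrank k (HochschildZero k A N) = Module.finrank k (P →ₗ[Env k A] N) := by
  obtain ⟨r, x, φ, hx⟩ := exists_finite_dualBasis (R := Env k A) P
  rw [le_antisymm (he.range_lcomp_le_ker_contractHom hx) (he.ker_contractHom_le_range_lcomp hx),
    add_comm, ← finrank_top k (HochschildZero k A N),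
    ← LinearMap.range_eq_top.2 (he.contractHom_surjective hx)]
  exact LinearMap.finrank_range_add_finrank_ker _

end IsDualCokernel

end DualCokernel

section TraceDuality

/-- The trace form `(f, g) ↦ tr(f g)` on `End(V)`. -/
def endTraceForm (k V : Type*) [Field k] [AddCommGroup V] [Module k V] :
    LinearMap.BilinForm k (Module.End k V) :=
  (LinearMap.mul k (Module.End k V)).compr₂ (LinearMap.trace k V)

lemma endTraceForm_apply {k V : Type*} [Field k] [AddCommGroup V] [Module k V]
    (f g : Module.End k V) : endTraceForm k V f g = LinearMap.trace k V (f * g) := rfl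

/-- The trace of the product of `f` and the rank one map `w ↦ φ(w) v` is `φ (f v)`. -/
lemma endTraceForm_nondegenerate (k V : Type*) [Field k] [AddCommGroup V] [Module k V]
    [FiniteDimensional k V] : (endTraceForm k V).Nondegenerate := by
  have hrefl : (endTraceForm k V).IsRefl := fun f g h => (LinearMap.trace_mul_comm k g f).trans h
  refine hrefl.nondegenerate_iff_separatingLeft.2 fun f hf => LinearMap.ext fun v =>
    (Module.forall_dual_apply_eq_zero_iff k (f v)).1 fun φ => ?_
  have hmul : f * dualTensorHom k V V (φ ⊗ₜ v) = dualTensorHom k V V (φ ⊗ₜ f v) := by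
    ext w
    simp
  have h := hf (dualTensorHom k V V (φ ⊗ₜ v))
  rwa [endTraceForm_apply, hmul, LinearMap.trace_eq_contract_apply, contractLeft_apply] at h

variable {k A : Type u} [Field k] [Ring A] [Algebra k A] {n : ℕ}

namespace RepPt

variable (M : RepPt k A n)

instance : IsScalarTower k A M.Mod where
  smul_assoc c a v := by simp [smul_def]

lemma endTraceForm_ncDiff_smul (a : A) (f g : Module.End k M.Mod) :
    endTraceForm k M.Mod ((ncDiff k a : Env k A) • f) g =
      endTraceForm k M.Mod (g * M.toEnd a - M.toEnd a * g) f := by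
  have h : (ncDiff k a : Env k A) • f = M.toEnd a * f - f * M.toEnd a := by
    rw [ncDiff, sub_smul, tmul_smul, tmul_smul, map_one, mul_one, one_mul]
  rw [endTraceForm_apply, endTraceForm_apply, h, sub_mul, sub_mul, map_sub, map_sub,
    LinearMap.trace_mul_comm k (M.toEnd a * f), mul_assoc f, LinearMap.trace_mul_comm k f,
    ← mul_assoc]

lemma mem_orthogonal_commutatorSpace_iff {g : Module.End k M.Mod} :
    g ∈ (endTraceForm k M.Mod).orthogonal (commutatorSpace k A (Module.End k M.Mod)) ↔
      ∀ a, g * M.toEnd a = M.toEnd a * g := by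
  constructor
  · refine fun hg a => sub_eq_zero.1 ((endTraceForm_nondegenerate k M.Mod).1 _ fun f => ?_)
    rw [← endTraceForm_ncDiff_smul]
    exact hg _ (Submodule.subset_span ⟨a, f, rfl⟩)
  · intro hg
    suffices h : commutatorSpace k A (Module.End k M.Mod) ≤
      LinearMap.ker ((endTraceForm k M.Mod).flip g) from h
    refine Submodule.span_le.2 ?_
    rintro _ ⟨a, f, rfl⟩
    change endTraceForm k M.Mod _ g = 0
    rw [endTraceForm_ncDiff_smul, sub_eq_zero.2 (hg a), map_zero, LinearMap.zero_apply]

lemma range_restrictScalars_eq_orthogonal :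
    LinearMap.range (LinearMap.restrictScalarsₗ k A M.Mod M.Mod k) =
      (endTraceForm k M.Mod).orthogonal (commutatorSpace k A (Module.End k M.Mod)) := by
  ext g
  refine Iff.trans ⟨?_, fun hg => ⟨⟨⟨g, map_add g⟩, fun a v => LinearMap.congr_fun (hg a) v⟩, rfl⟩⟩
    M.mem_orthogonal_commutatorSpace_iff.symm
  rintro ⟨f, rfl⟩ a
  exact LinearMap.ext fun v => map_smul f a v

lemma finrank_hochschildZero_end :
    Module.finrank k (HochschildZero k A (Module.End k M.Mod)) =
      Module.finrank k (Module.End A M.Mod) := by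
  rw [← LinearMap.finrank_range_of_inj (f := LinearMap.restrictScalarsₗ k A M.Mod M.Mod k)
      (LinearMap.restrictScalars_injective k), M.range_restrictScalars_eq_orthogonal,
    LinearMap.BilinForm.finrank_orthogonal (endTraceForm_nondegenerate k M.Mod),
    Submodule.finrank_quotient]

end RepPt

end TraceDuality

/-! ### The dimension of the tangent space -/

section Main

variable {k A : Type u} [Field k] [Ring A] [Algebra k A]

lemma IsCalabiYau.exists_isDualCokernel (hA : IsCalabiYau k A 2)
    (P : ProjectiveResolution (diagBimod k A)) :
    ∃ e : (boundaries P 1 →ₗ[Env k A] Env k A) →+ A,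
      IsDualCokernel (boundaries P 1).subtype e := by
  obtain ⟨ε, hε⟩ := hA.ext_iso
  refine ⟨ε.toAddMonoidHom.comp (boundaryExt P (envBimod k A) 1),
    ε.surjective.comp (boundaryExt_surjective P _ 1), fun ξ => ?_, fun a b ξ => ?_⟩
  · exact (map_eq_zero_iff ε ε.injective).trans (boundaryExt_eq_zero_iff P _ 1)
  · refine Eq.trans ?_ (hε a b (boundaryExt P (envBimod k A) 1 ξ))
    rw [← boundaryExt_comp]
    rfl

lemma RepPt.finrank_tangentSpace_add {n : ℕ} (M : RepPt k A n) (hA : IsCalabiYau k A 2)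
    (P : ProjectiveResolution (diagBimod k A)) (hP : ∀ i, Module.Finite (Env k A) (P.complex.X i))
    [Module.Projective (Env k A) (boundaries P 1)] :
    Module.finrank k M.TangentSpace +
        Module.finrank k (P.complex.X 0 →ₗ[Env k A] Module.End k M.Mod) +
        Module.finrank k (boundaries P 1 →ₗ[Env k A] Module.End k M.Mod) =
      Module.finrank k (Module.End A M.Mod) +
        Module.finrank k (Env k A →ₗ[Env k A] Module.End k M.Mod) +
        Module.finrank k (P.complex.X 1 →ₗ[Env k A] Module.End k M.Mod) := by
  obtain ⟨e, he⟩ := hA.exists_isDualCokernel P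
  have hB₁ : Module.Finite (Env k A) (boundaries P 1) := finite_boundaries P 1
  have hB₀ : Module.Finite (Env k A) (LinearMap.ker (augmentation P)) :=
    ker_augmentation P ▸ finite_boundaries P 0
  have hschanuel := finrank_hom_ker_add_finrank_hom (k := k) (N := Module.End k M.Mod)
    (augmentation_surjective P) (envMul_surjective (k := k) (A := A))
  have hrange := finrank_hom_add_finrank_range_lcomp (k := k) (N := Module.End k M.Mod)
    (exact_subtype_toBoundaries P 0) (toBoundaries_surjective P 0)
  have hduality := he.finrank_range_lcomp_add_finrank_hochschildZero (k := k)
    (N := Module.End k M.Mod)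
  rw [ker_augmentation, ← M.finrank_tangentSpace] at hschanuel
  rw [M.finrank_hochschildZero_end] at hduality
  lia

lemma IsCalabiYau.exists_isLocallyConstant_finrank_tangentSpace (hA : IsCalabiYau k A 2) (n : ℕ) :
    ∃ N : RepPt k A n → ℤ, IsLocallyConstant N ∧ ∀ M : RepPt k A n,
      (Module.finrank k M.TangentSpace : ℤ) = N M + Module.finrank k (Module.End A M.Mod) := by
  obtain ⟨P, hfin, m, hm⟩ := hA.smooth
  have hfin₁ : Module.Finite (Env k A) (boundaries P 1) := finite_boundaries P 1
  have hproj₁ : Module.Projective (Env k A) (boundaries P 1) :=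
    projective_boundaries P (d := 2) hfin hm (fun i hi => hA.ext_eq_zero i hi.ne') le_rfl
  have hloc (Y : Type u) [AddCommGroup Y] [Module (Env k A) Y] [Module.Finite (Env k A) Y]
      [Module.Projective (Env k A) Y] :=
    (isLocallyConstant_finrank_hom (k := k) (A := A) n Y).comp (Nat.cast : ℕ → ℤ)
  refine ⟨_, ((hloc (P.complex.X 1)).sub (hloc (boundaries P 1))).add
    ((hloc (Env k A)).sub (hloc (P.complex.X 0))), fun M => ?_⟩
  have h := M.finrank_tangentSpace_add hA P hfin
  simp only [Pi.add_apply, Pi.sub_apply, Function.comp_apply]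
  lia

end Main

end CYRep

end

theorem mainTheorem4_general {k A : Type u} [Field k] [Ring A] [Algebra k A] (n : ℕ)
    (hA : CYRep.IsCalabiYau k A 2) :
    (∃ N : CYRep.RepPt k A n → ℤ, IsLocallyConstant N ∧
      ∀ M : CYRep.RepPt k A n,
        (Module.finrank k M.TangentSpace : ℤ) = N M + Module.finrank k (Module.End A M.Mod)) ∧
    (∀ Z ∈ irreducibleComponents (CYRep.RepPt k A n), ∃ f : ℕ → ℤ, StrictMono f ∧
      ∀ M ∈ Z,
        (Module.finrank k M.TangentSpace : ℤ) = f (Module.finrank k (Module.End A M.Mod))) := by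
  obtain ⟨N, hN, h⟩ := hA.exists_isLocallyConstant_finrank_tangentSpace n
  refine ⟨⟨N, hN, h⟩, fun Z hZ => ?_⟩
  obtain ⟨M₀, hM₀⟩ := hZ.1.nonempty
  refine ⟨fun d => N M₀ + d, fun a b hab => by simpa using hab, fun M hM => ?_⟩
  rw [h M, hN.apply_eq_of_isPreconnected hZ.1.isPreirreducible.isPreconnected hM hM₀]

theorem mainTheorem4 {k A : Type u} [Field k] [IsAlgClosed k] [CharZero k]
    [Ring A] [Algebra k A] [Algebra.FiniteType k A] (n : ℕ)
    (hA : CYRep.IsCalabiYau k A 2)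
    (F : CategoryTheory.ProjectiveResolution (CYRep.diagBimod k A))
    (hF : ∀ i, Module.Finite (CYRep.Env k A) (F.complex.X i))
    (hc : ∀ i ≤ 2, IsLocallyConstant fun M : CYRep.RepPt k A n =>
      Module.finrank k (F.complex.X i →ₗ[CYRep.Env k A] Module.End k M.Mod)) :
    (∃ N : CYRep.RepPt k A n → ℤ, IsLocallyConstant N ∧
      ∀ M : CYRep.RepPt k A n,
        (Module.finrank k M.TangentSpace : ℤ) = N M + Module.finrank k (Module.End A M.Mod)) ∧
    (∀ Z ∈ irreducibleComponents (CYRep.RepPt k A n), ∃ f : ℕ → ℤ, StrictMono f ∧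
      ∀ M ∈ Z,
        (Module.finrank k M.TangentSpace : ℤ) = f (Module.finrank k (Module.End A M.Mod))) :=
  mainTheorem4_general n hA
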